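/- Let $n\ge 0$, $T\ge 0$, let $D\in\mathbb R^{n\times n}$ be a diagonal matrix and let $\Sigma_0\in\mathbb R^{n\times n}$ be symmetric positive definite. Let $\mathcal R(\Sigma_0,D,T)$ denote the set of all symmetric positive definite matrices $\Sigma_T\in\mathbb R^{n\times n}$ for which there are a (Lebesgue) measurable map $t\mapsto U_t\in O(n)$ on $[0,T]$ and an absolutely continuous matrix function $t\mapsto\Sigma_t$ on $[0,T]$ with the prescribed values $\Sigma_0$ at $t=0$ and $\Sigma_T$ at $t=T$ such that $$\dot\Sigma_t=A_t\Sigma_t+\Sigma_tA_t\quad\text{for almost every }t\in[0,T],\qquad A_t=U_tDU_t^\top .$$ For $x\in\mathbb R^n$ let $x^\downarrow$ be the vector of the entries of $x$ rearranged in decreasing order, and for $x,y\in\mathbb R^n$ write $x\prec y$ ($x$ is majorized by $y$) if $\sum_{i=1}^n x_i=\sum_{i=1}^n y_i$ and $\sum_{i=1}^k x_i^\downarrow\le\sum_{i=1}^k y_i^\downarrow$ for all $k\in\{1,\dots,n-1\}$. If $\Sigma_T\in\mathcal R(\Sigma_0,D,T)$, then $$\log\boldsymbol\lambda_T\prec\log\boldsymbol\lambda_0^\downarrow+2T\boldsymbol\lambda_D^\downarrow,$$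 where $\log\boldsymbol\lambda_T$, $\log\boldsymbol\lambda_0$ and $\boldsymbol\lambda_D$ are the vectors of eigenvalues, counted with multiplicity, of the matrix logarithms $\log\Sigma_T$ and $\log\Sigma_0$ and of $D$, respectively, and the two vectors on the right-hand side are added after each has been sorted in decreasing order. -/

import Mathlib

open MeasureTheory

/-- The entries of `x` rearranged in decreasing order. -/
noncomputable def sortDesc {n : ℕ} (x : Fin n → ℝ) : Fin n → ℝ :=
  x ∘ Tuple.sort (fun i => -x i)

theorem sortDesc_antitone {n : ℕ} (x : Fin n → ℝ) : Antitone (sortDesc x) := by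
  intro i j hij
  have h := Tuple.monotone_sort (fun i => -x i) hij
  simpa [sortDesc] using h

/-- Vector majorization `x ≺ y`: equal total sums, and for every `1 ≤ k ≤ n - 1` the sum of the
`k` largest entries of `x` is at most the sum of the `k` largest entries of `y`. -/
def Majorized {n : ℕ} (x y : Fin n → ℝ) : Prop :=
  ∑ i, x i = ∑ i, y i ∧
    ∀ k : ℕ, 1 ≤ k → k < n →
      ∑ i : Fin n with i.val < k, sortDesc x i ≤ ∑ i : Fin n with i.val < k, sortDesc y i

/-- The principal logarithm of a real symmetric positive definite matrix, by spectral calculus. -/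
noncomputable def matrixLog {n : ℕ} (S : Matrix (Fin n) (Fin n) ℝ) : Matrix (Fin n) (Fin n) ℝ :=
  cfc Real.log S

theorem isHermitian_matrixLog {n : ℕ} (S : Matrix (Fin n) (Fin n) ℝ) :
    (matrixLog S).IsHermitian :=
  (cfc_predicate Real.log S : IsSelfAdjoint (cfc Real.log S))

theorem isHermitian_of_isDiag {n : ℕ} {D : Matrix (Fin n) (Fin n) ℝ} (hD : D.IsDiag) :
    D.IsHermitian := by
  rw [Matrix.IsHermitian, Matrix.conjTranspose_eq_transpose_of_trivial]
  exact hD.isSymm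

/-- An isospectral control on `[0, T]`: an orthogonal-matrix valued map `U` with (Lebesgue)
measurable entries. The gain matrix at time `t` is `U t * D * (U t)ᵀ`. -/
structure IsIsospectralControl {n : ℕ} (T : ℝ) (U : ℝ → Matrix (Fin n) (Fin n) ℝ) : Prop where
  orthogonal : ∀ t ∈ Set.Icc 0 T, U t ∈ Matrix.orthogonalGroup (Fin n) ℝ
  measurable : ∀ i j, AEMeasurable (fun t => U t i j) (volume.restrict (Set.Icc 0 T))

/-- `S` solves the Lyapunov equation `S' = A S + S A` on `[0, T]` in the sense of Carathéodory:
it is absolutely continuous and satisfies the equation at almost every time. -/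
structure IsLyapunovSolution {n : ℕ} (T : ℝ) (A S : ℝ → Matrix (Fin n) (Fin n) ℝ) : Prop where
  absolutelyContinuous : ∀ i j, AbsolutelyContinuousOnInterval (fun t => S t i j) 0 T
  equation : ∀ᵐ t ∂(volume.restrict (Set.Icc 0 T)),
    ∀ i j, HasDerivAt (fun s => S s i j) ((A t * S t + S t * A t) i j) t

/-- The set of positive definite matrices `S_T` to which the Lyapunov equation can be steered in
time `T` from `S₀` by a gain `U t * D * (U t)ᵀ` with `U` an isospectral control. -/
def reachableSet {n : ℕ} (S₀ D : Matrix (Fin n) (Fin n) ℝ) (T : ℝ) :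
    Set (Matrix (Fin n) (Fin n) ℝ) :=
  {S_T | S_T.PosDef ∧ ∃ U S : ℝ → Matrix (Fin n) (Fin n) ℝ,
    IsIsospectralControl T U ∧
    IsLyapunovSolution T (fun t => U t * D * (U t).transpose) S ∧
    S 0 = S₀ ∧ S T = S_T}

/-! The sum of the `k` largest eigenvalues of `S t` is the maximum of a trace over orthonormal
`k`-frames (Ky Fan), hence Lipschitz in the entries and absolutely continuous in time. Where it is
differentiable, freezing an eigenbasis `W` of `S t` gives a smooth function touching it from below,
so both have the same derivative. Thus almost everywhere each sorted eigenvalue satisfies `λᵢ' = 2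
(Qᵀ D Q)ᵢᵢ λᵢ` with `Q = Uᵀ W` orthogonal (`hasDerivAt_sortDesc_eigenvalues`), even at eigenvalue
crossings.

The eigenvalues therefore stay positive, and `log λᵢ` has derivative `2 (Qᵀ D Q)ᵢᵢ`. Ky Fan's
inequality for `D` bounds the partial sums of these rates, and the trace fixes the full sum.
Integrating over `[0, T]` gives the majorization. -/

namespace AbsolutelyContinuousOnInterval

/-! ### Absolutely continuous functions and differential inequalities -/

theorem of_dist_le {ι : Type*} {s : Finset ι} {f : ℝ → ℝ} {g : ι → ℝ → ℝ} {a b C : ℝ}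
    (hg : ∀ p ∈ s, AbsolutelyContinuousOnInterval (g p) a b)
    (h : ∀ x ∈ Set.uIcc a b, ∀ y ∈ Set.uIcc a b, |f x - f y| ≤ C * ∑ p ∈ s, |g p x - g p y|) :
    AbsolutelyContinuousOnInterval f a b := by
  have key : Filter.Tendsto (fun E : ℕ × (ℕ → ℝ × ℝ) => C * ∑ p ∈ s,
      ∑ i ∈ Finset.range E.1, dist (g p (E.2 i).1) (g p (E.2 i).2))
      (totalLengthFilter ⊓ Filter.principal (disjWithin a b)) (nhds 0) := by
    have := (tendsto_finsetSum s (fun p hp => hg p hp)).const_mul C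
    simpa using this
  refine squeeze_zero' (Filter.Eventually.of_forall fun E =>
    Finset.sum_nonneg fun i _ => dist_nonneg) ?_ key
  refine Filter.Eventually.filter_mono inf_le_right ?_
  rw [Filter.eventually_principal]
  intro E hE
  rw [Finset.sum_comm, Finset.mul_sum]
  refine Finset.sum_le_sum fun i hi => ?_
  simpa [Real.dist_eq] using h _ (hE.1 i hi).1 _ (hE.1 i hi).2

theorem finset_sum {ι : Type*} {s : Finset ι} {g : ι → ℝ → ℝ} {a b : ℝ}
    (hg : ∀ p ∈ s, AbsolutelyContinuousOnInterval (g p) a b) :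
    AbsolutelyContinuousOnInterval (fun t => ∑ p ∈ s, g p t) a b := by
  refine of_dist_le (C := 1) hg fun x _ y _ => ?_
  rw [← Finset.sum_sub_distrib, one_mul]
  exact Finset.abs_sum_le_sum_abs _ _

/-- By compactness `f` has a positive minimum `m`, and `Real.log` is Lipschitz with constant `1 / m`
on `[m, ∞)`. -/
theorem log {f : ℝ → ℝ} {a b : ℝ} (hf : AbsolutelyContinuousOnInterval f a b)
    (hpos : ∀ t ∈ Set.uIcc a b, 0 < f t) :
    AbsolutelyContinuousOnInterval (fun t => Real.log (f t)) a b := by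
  obtain ⟨z, hz, hmin⟩ := isCompact_uIcc.exists_isMinOn Set.nonempty_uIcc hf.continuousOn
  have hm : 0 < f z := hpos z hz
  have aux : ∀ x ∈ Set.uIcc a b, ∀ y ∈ Set.uIcc a b,
      Real.log (f x) - Real.log (f y) ≤ (f z)⁻¹ * |f x - f y| := by
    intro x hx y hy
    have hx0 := hpos x hx
    have hy0 := hpos y hy
    rw [← Real.log_div hx0.ne' hy0.ne']
    calc Real.log (f x / f y) ≤ f x / f y - 1 := Real.log_le_sub_one_of_pos (by positivity)
      _ = (f y)⁻¹ * (f x - f y) := by field_simp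
      _ ≤ (f y)⁻¹ * |f x - f y| := by gcongr; exact le_abs_self _
      _ ≤ (f z)⁻¹ * |f x - f y| := by gcongr; exact hmin hy
  refine of_dist_le (s := {()}) (g := fun _ => f) (C := (f z)⁻¹) (fun _ _ => hf) ?_
  intro x hx y hy
  rw [Finset.sum_singleton, abs_le]
  have h1 := aux x hx y hy
  have h2 := aux y hy x hx
  rw [abs_sub_comm] at h2
  constructor <;> linarith

/-- The pointwise existential in `hd` lets the derivative depend on an eigenbasis chosen separately
at each time, with no measurable selection. -/
theorem sub_le_of_ae_hasDerivAt_le {f : ℝ → ℝ} {a b c : ℝ} (hab : a ≤ b)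
    (hf : AbsolutelyContinuousOnInterval f a b)
    (hd : ∀ᵐ t ∂(volume.restrict (Set.Icc a b)), ∃ f', HasDerivAt f f' t ∧ f' ≤ c) :
    f b - f a ≤ c * (b - a) := by
  rw [← hf.integral_deriv_eq_sub]
  calc ∫ x in a..b, deriv f x ≤ ∫ _ in a..b, c := by
        refine intervalIntegral.integral_mono_ae_restrict hab hf.intervalIntegrable_deriv
          intervalIntegrable_const ?_
        filter_upwards [hd] with t ⟨f', ht⟩
        rw [ht.1.deriv]
        exact ht.2
    _ = c * (b - a) := by simp [mul_comm]

/-- A Grönwall argument: `y² exp (2 C t)` is nondecreasing, so `y` cannot reach zero, and by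
continuity it keeps its sign. -/
theorem pos_of_ae_hasDerivAt_mul {y : ℝ → ℝ} {a b C : ℝ}
    (hy : AbsolutelyContinuousOnInterval y a b) (h0 : 0 < y a)
    (hd : ∀ᵐ t ∂(volume.restrict (Set.Icc a b)), ∃ c, HasDerivAt y (c * y t) t ∧ |c| ≤ C) :
    ∀ t ∈ Set.Icc a b, 0 < y t := by
  have hab' : ∀ {t}, t ∈ Set.Icc a b → Set.uIcc a t ⊆ Set.uIcc a b := fun {t} ht => by
    rw [Set.uIcc_of_le ht.1, Set.uIcc_of_le (ht.1.trans ht.2)]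
    exact Set.Icc_subset_Icc le_rfl ht.2
  have hne : ∀ t ∈ Set.Icc a b, y t ≠ 0 := by
    intro t ht hyt
    have hy' := hy.mono (hab' ht)
    have hE : AbsolutelyContinuousOnInterval (fun s => Real.exp (2 * C * s)) a t :=
      ContDiffOn.absolutelyContinuousOnInterval (by fun_prop)
    have hAC := ((hy'.mul hy').mul hE).neg
    have := hAC.sub_le_of_ae_hasDerivAt_le (c := 0) ht.1 (by
        filter_upwards [ae_restrict_of_ae_restrict_of_subset
          (Set.Icc_subset_Icc le_rfl ht.2) hd] with s ⟨c, hs⟩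
        refine ⟨-((2 * c + 2 * C) * y s ^ 2 * Real.exp (2 * C * s)), ?_, ?_⟩
        · have h1 : HasDerivAt (fun s : ℝ => Real.exp (2 * C * s))
              (Real.exp (2 * C * s) * (2 * C)) s := by
            simpa using ((hasDerivAt_id s).const_mul (2 * C)).exp
          convert! ((hs.1.mul hs.1).mul h1).neg using 1
          simp only [Pi.mul_apply]
          ring
        · have := (abs_le.1 hs.2).1
          have : 0 ≤ 2 * c + 2 * C := by linarith
          have := mul_nonneg (mul_nonneg this (sq_nonneg (y s))) (Real.exp_pos (2 * C * s)).le
          linarith)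
    simp only [Pi.neg_apply, Pi.mul_apply, hyt] at this
    have h2 : 0 < y a * y a * Real.exp (2 * C * a) := by positivity
    linarith
  intro t ht
  by_contra hcon
  have hc : ContinuousOn y (Set.Icc a t) := by
    have := hy.continuousOn.mono (hab' ht)
    rwa [Set.uIcc_of_le ht.1] at this
  obtain ⟨s, hs, hs0⟩ := intermediate_value_Icc' ht.1 hc ⟨not_lt.1 hcon, h0.le⟩
  exact hne s ⟨hs.1, hs.2.trans ht.2⟩ hs0

end AbsolutelyContinuousOnInterval

/-- `f - g` has a minimum at `t`, so its derivative vanishes there. -/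
theorem HasDerivAt.of_le_of_eq {f g : ℝ → ℝ} {t g' : ℝ} (hf : DifferentiableAt ℝ f t)
    (hg : HasDerivAt g g' t) (hle : ∀ s, g s ≤ f s) (heq : g t = f t) : HasDerivAt f g' t := by
  have h : IsLocalMin (f - g) t := Filter.Eventually.of_forall fun s => by
    simp only [Pi.sub_apply, heq, sub_self, sub_nonneg]
    exact hle s
  have := h.hasDerivAt_eq_zero (hf.hasDerivAt.sub hg)
  rw [← sub_eq_zero.1 this]
  exact hf.hasDerivAt

/-! ### Sorted vectors and the spectrum of the logarithm -/

theorem Antitone.eq_of_map_univ_eq {n : ℕ} {x y : Fin n → ℝ} (hx : Antitone x)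
    (hy : Antitone y) (h : Multiset.map x Finset.univ.val = Multiset.map y Finset.univ.val) :
    x = y := by
  rw [← List.ofFn_inj]
  refine List.Perm.eq_of_pairwise' (r := (· ≥ ·)) ?_ ?_ ?_
  · rw [List.pairwise_ofFn]
    exact fun i j hij => hx hij.le
  · rw [List.pairwise_ofFn]
    exact fun i j hij => hy hij.le
  · rw [← Multiset.coe_eq_coe]
    simpa [Fin.univ_val_map] using h

theorem map_sortDesc {n : ℕ} (x : Fin n → ℝ) :
    Multiset.map (sortDesc x) Finset.univ.val = Multiset.map x Finset.univ.val := by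
  rw [sortDesc, ← Multiset.map_map]
  congr 1
  exact Multiset.map_univ_val_equiv _

theorem sortDesc_eq_self {n : ℕ} {x : Fin n → ℝ} (hx : Antitone x) : sortDesc x = x :=
  Antitone.eq_of_map_univ_eq (sortDesc_antitone x) hx (map_sortDesc x)

theorem sum_sortDesc {n : ℕ} (x : Fin n → ℝ) : ∑ i, sortDesc x i = ∑ i, x i :=
  Equiv.sum_comp (Tuple.sort fun i => -x i) x

/-- Both sides are decreasing, as `Real.log` is monotone on positive reals, and both list the roots
of the characteristic polynomial of `matrixLog S`. -/
theorem sortDesc_eigenvalues_matrixLog {n : ℕ} {S : Matrix (Fin n) (Fin n) ℝ} (hS : S.PosDef) :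
    sortDesc (isHermitian_matrixLog S).eigenvalues
      = fun i => Real.log (sortDesc hS.isHermitian.eigenvalues i) := by
  refine Antitone.eq_of_map_univ_eq (sortDesc_antitone _) ?_ ?_
  · intro i j hij
    exact Real.log_le_log (hS.eigenvalues_pos _) (sortDesc_antitone _ hij)
  · rw [map_sortDesc]
    have h1 := (isHermitian_matrixLog S).roots_charpoly_eq_eigenvalues
    have h2 : (matrixLog S).charpoly.roots
        = Multiset.map (fun i => Real.log (hS.isHermitian.eigenvalues i)) Finset.univ.val := by
      rw [matrixLog, hS.isHermitian.charpoly_cfc_eq, Polynomial.roots_prod]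
      · simp
      · simp [Finset.prod_ne_zero_iff, Polynomial.X_sub_C_ne_zero]
    rw [h2] at h1
    have h3 := map_sortDesc hS.isHermitian.eigenvalues
    have h4 : Multiset.map (fun i => Real.log (sortDesc hS.isHermitian.eigenvalues i))
        Finset.univ.val = Multiset.map (fun i => Real.log (hS.isHermitian.eigenvalues i))
          Finset.univ.val := by
      have := congrArg (Multiset.map Real.log) h3
      simpa [Multiset.map_map, Function.comp_def] using this
    rw [h4, h1]
    rfl

/-! ### Orthogonal conjugation and Ky Fan's inequality -/

namespace Matrix

theorem sum_sq_row_of_mem_orthogonalGroup {n : ℕ} {P : Matrix (Fin n) (Fin n) ℝ}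
    (hP : P ∈ orthogonalGroup (Fin n) ℝ) (i : Fin n) : ∑ j, P i j ^ 2 = 1 := by
  have := congrFun (congrFun ((mem_orthogonalGroup_iff _ _).1 hP) i) i
  simpa [mul_apply, sq] using this

theorem transpose_mem_orthogonalGroup {n : ℕ} {P : Matrix (Fin n) (Fin n) ℝ}
    (hP : P ∈ orthogonalGroup (Fin n) ℝ) : Pᵀ ∈ orthogonalGroup (Fin n) ℝ := by
  rw [mem_orthogonalGroup_iff]
  simpa [star_eq_conjTranspose] using (mem_orthogonalGroup_iff' _ _).1 hP

theorem sum_sq_col_of_mem_orthogonalGroup {n : ℕ} {P : Matrix (Fin n) (Fin n) ℝ}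
    (hP : P ∈ orthogonalGroup (Fin n) ℝ) (j : Fin n) : ∑ i, P i j ^ 2 = 1 :=
  sum_sq_row_of_mem_orthogonalGroup (transpose_mem_orthogonalGroup hP) j

theorem transpose_mul_self_of_mem_orthogonalGroup {n : ℕ} {P : Matrix (Fin n) (Fin n) ℝ}
    (hP : P ∈ orthogonalGroup (Fin n) ℝ) : Pᵀ * P = 1 := by
  simpa [star_eq_conjTranspose] using (mem_orthogonalGroup_iff' _ _).1 hP

theorem mul_transpose_self_of_mem_orthogonalGroup {n : ℕ} {P : Matrix (Fin n) (Fin n) ℝ}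
    (hP : P ∈ orthogonalGroup (Fin n) ℝ) : P * Pᵀ = 1 := by
  simpa [star_eq_conjTranspose] using (mem_orthogonalGroup_iff _ _).1 hP

theorem abs_le_one_of_mem_orthogonalGroup {n : ℕ} {P : Matrix (Fin n) (Fin n) ℝ}
    (hP : P ∈ orthogonalGroup (Fin n) ℝ) (i j : Fin n) : |P i j| ≤ 1 := by
  rw [← sq_le_one_iff_abs_le_one, ← sum_sq_row_of_mem_orthogonalGroup hP i]
  exact Finset.single_le_sum (f := fun j => P i j ^ 2) (fun j _ => sq_nonneg _) (Finset.mem_univ j)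

theorem transpose_mul_mul_apply_self {n : ℕ} (Q M : Matrix (Fin n) (Fin n) ℝ) (i : Fin n) :
    (Qᵀ * M * Q) i i = ∑ p, ∑ q, Q p i * Q q i * M p q := by
  simp only [mul_apply, transpose_apply, Finset.sum_mul]
  rw [Finset.sum_comm]
  refine Finset.sum_congr rfl fun p _ => Finset.sum_congr rfl fun q _ => ?_
  ring

/-- **Ky Fan's inequality** for a diagonal matrix with decreasing entries. -/
theorem sum_conj_diagonal_le {n : ℕ} {P : Matrix (Fin n) (Fin n) ℝ}
    (hP : P ∈ orthogonalGroup (Fin n) ℝ) {l : Fin n → ℝ} (hl : Antitone l) (k : ℕ) :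
    ∑ i : Fin n with i.val < k, (Pᵀ * diagonal l * P) i i ≤ ∑ i : Fin n with i.val < k, l i := by
  -- A threshold separating the first `k` entries from the rest; for `k ≥ n` any lower bound serves.
  obtain ⟨μ, hμ⟩ : ∃ μ : ℝ, ∀ j : Fin n, (j.val < k → μ ≤ l j) ∧ (¬ j.val < k → l j ≤ μ) := by
    by_cases hk : k < n
    · exact ⟨l ⟨k, hk⟩, fun j => ⟨fun h => hl (Fin.le_def.2 h.le),
        fun h => hl (Fin.le_def.2 (not_lt.1 h))⟩⟩
    · refine ⟨-∑ i, |l i|, fun j => ⟨fun _ => ?_, fun h => absurd j.2 (by omega)⟩⟩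
      have h1 := Finset.single_le_sum (f := fun i => |l i|) (fun i _ => abs_nonneg _)
        (Finset.mem_univ j)
      have h2 := neg_abs_le (l j)
      linarith
  set p : Fin n → ℝ := fun j => ∑ i : Fin n with i.val < k, P j i ^ 2 with hp
  have hp0 : ∀ j, 0 ≤ p j := fun j => Finset.sum_nonneg fun i _ => sq_nonneg _
  have hp1 : ∀ j, p j ≤ 1 := fun j => by
    rw [← sum_sq_row_of_mem_orthogonalGroup hP j]
    exact Finset.sum_le_sum_of_subset_of_nonneg (Finset.filter_subset _ _)
      fun i _ _ => sq_nonneg _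
  have hpsum : ∑ j, p j = ∑ j : Fin n, if j.val < k then (1 : ℝ) else 0 := by
    rw [← Finset.sum_filter, hp, Finset.sum_comm]
    exact Finset.sum_congr rfl fun i _ => sum_sq_col_of_mem_orthogonalGroup hP i
  have hL : ∑ i : Fin n with i.val < k, (Pᵀ * diagonal l * P) i i = ∑ j, l j * p j := by
    simp only [hp, Finset.mul_sum]
    rw [Finset.sum_comm]
    refine Finset.sum_congr rfl fun i _ => ?_
    rw [mul_apply]
    refine Finset.sum_congr rfl fun j _ => ?_
    rw [mul_diagonal, transpose_apply]
    ring
  -- The weights `p j` lie in `[0, 1]` and have the same total as the indicator of `j < k`, so `μ`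
  -- cancels after summation.
  have hterm : ∀ j : Fin n, 0 ≤ (l j - μ) * ((if j.val < k then (1 : ℝ) else 0) - p j) := by
    intro j
    split_ifs with h
    · exact mul_nonneg (sub_nonneg.2 ((hμ j).1 h)) (sub_nonneg.2 (hp1 j))
    · exact mul_nonneg_of_nonpos_of_nonpos (sub_nonpos.2 ((hμ j).2 h)) (by linarith [hp0 j])
  have hsum := Finset.sum_nonneg fun j (_ : j ∈ Finset.univ) => hterm j
  have hexp : ∑ j : Fin n, (l j - μ) * ((if j.val < k then (1 : ℝ) else 0) - p j)
      = (∑ j : Fin n, if j.val < k then l j else 0) - ∑ j, l j * p j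
        - μ * ((∑ j : Fin n, if j.val < k then (1 : ℝ) else 0) - ∑ j, p j) := by
    rw [← Finset.sum_sub_distrib, ← Finset.sum_sub_distrib, Finset.mul_sum,
      ← Finset.sum_sub_distrib]
    refine Finset.sum_congr rfl fun j _ => ?_
    split_ifs <;> ring
  rw [hexp, hpsum, sub_self, mul_zero, sub_zero, ← Finset.sum_filter] at hsum
  rw [hL]
  linarith

theorem IsHermitian.exists_orthogonal_diagonal_sortDesc {n : ℕ} {S : Matrix (Fin n) (Fin n) ℝ}
    (hS : S.IsHermitian) : ∃ W ∈ orthogonalGroup (Fin n) ℝ,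
      S = W * diagonal (sortDesc hS.eigenvalues) * Wᵀ := by
  set σ := Tuple.sort (fun i => -hS.eigenvalues i) with hσ
  set V : Matrix (Fin n) (Fin n) ℝ := hS.eigenvectorUnitary.1 with hV
  have hVO : V ∈ orthogonalGroup (Fin n) ℝ := hS.eigenvectorUnitary.2
  refine ⟨V.submatrix id σ, ?_, ?_⟩
  · rw [mem_orthogonalGroup_iff]
    ext i j
    have := congrFun (congrFun (mul_transpose_self_of_mem_orthogonalGroup hVO) i) j
    rw [← this]
    simp only [mul_apply, submatrix_apply, id, transpose_apply]
    exact Equiv.sum_comp σ (fun x => V i x * V j x)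
  · have h := hS.spectral_theorem
    rw [Unitary.conjStarAlgAut_apply] at h
    ext i j
    have hij := congrFun (congrFun h i) j
    rw [hij]
    rw [mul_apply, mul_apply]
    simp only [mul_diagonal, submatrix_apply, id, transpose_apply, sortDesc,
      Function.comp_apply, star_apply, star_trivial]
    rw [← Equiv.sum_comp σ]
    rfl

/-- **Ky Fan's inequality**. -/
theorem IsHermitian.sum_conj_le {n : ℕ} {S : Matrix (Fin n) (Fin n) ℝ} (hS : S.IsHermitian)
    {Q : Matrix (Fin n) (Fin n) ℝ} (hQ : Q ∈ orthogonalGroup (Fin n) ℝ) (k : ℕ) :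
    ∑ i : Fin n with i.val < k, (Qᵀ * S * Q) i i
      ≤ ∑ i : Fin n with i.val < k, sortDesc hS.eigenvalues i := by
  obtain ⟨W, hW, h⟩ := hS.exists_orthogonal_diagonal_sortDesc
  have := sum_conj_diagonal_le (mul_mem (transpose_mem_orthogonalGroup hW) hQ)
    (sortDesc_antitone hS.eigenvalues) k
  have e : (Wᵀ * Q)ᵀ * diagonal (sortDesc hS.eigenvalues) * (Wᵀ * Q) = Qᵀ * S * Q := by
    conv_rhs => rw [h]
    simp only [transpose_mul, transpose_transpose, Matrix.mul_assoc]
  rwa [e] at this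

theorem abs_conj_apply_self_le {n : ℕ} {Q : Matrix (Fin n) (Fin n) ℝ}
    (hQ : Q ∈ orthogonalGroup (Fin n) ℝ) (M : Matrix (Fin n) (Fin n) ℝ) (i : Fin n) :
    |(Qᵀ * M * Q) i i| ≤ ∑ p, ∑ q, |M p q| := by
  rw [transpose_mul_mul_apply_self]
  refine (Finset.abs_sum_le_sum_abs _ _).trans (Finset.sum_le_sum fun p _ => ?_)
  refine (Finset.abs_sum_le_sum_abs _ _).trans (Finset.sum_le_sum fun q _ => ?_)
  rw [abs_mul, abs_mul]
  have h1 := abs_le_one_of_mem_orthogonalGroup hQ p i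
  have h2 := abs_le_one_of_mem_orthogonalGroup hQ q i
  calc |Q p i| * |Q q i| * |M p q| ≤ 1 * 1 * |M p q| := by gcongr
    _ = |M p q| := by ring

/-- An eigenbasis of `S` attains the Ky Fan sum for `S` and is a competitor for `S'`; the gap is a
partial trace of the conjugate of `S - S'`. -/
theorem IsHermitian.sum_sortDesc_eigenvalues_sub_le {n : ℕ} {S S' : Matrix (Fin n) (Fin n) ℝ}
    (hS : S.IsHermitian) (hS' : S'.IsHermitian) (k : ℕ) :
    |∑ i : Fin n with i.val < k, sortDesc hS.eigenvalues i
      - ∑ i : Fin n with i.val < k, sortDesc hS'.eigenvalues i|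
      ≤ n * ∑ p : Fin n × Fin n, |S p.1 p.2 - S' p.1 p.2| := by
  have aux : ∀ {S S' : Matrix (Fin n) (Fin n) ℝ} (hS : S.IsHermitian) (hS' : S'.IsHermitian),
      ∑ i : Fin n with i.val < k, sortDesc hS.eigenvalues i
      - ∑ i : Fin n with i.val < k, sortDesc hS'.eigenvalues i
      ≤ n * ∑ p : Fin n × Fin n, |S p.1 p.2 - S' p.1 p.2| := by
    intro S S' hS hS'
    obtain ⟨W, hW, h⟩ := hS.exists_orthogonal_diagonal_sortDesc
    have hWW := transpose_mul_self_of_mem_orthogonalGroup hW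
    have hdiag : Wᵀ * S * W = diagonal (sortDesc hS.eigenvalues) := by
      conv_lhs => rw [h]
      rw [Matrix.mul_assoc, Matrix.mul_assoc, Matrix.mul_assoc, hWW, Matrix.mul_one,
        ← Matrix.mul_assoc, hWW, Matrix.one_mul]
    have hle := hS'.sum_conj_le hW k
    have hEq : ∀ i, sortDesc hS.eigenvalues i
        = (Wᵀ * S' * W) i i + (Wᵀ * (S - S') * W) i i := fun i => by
      rw [← add_apply, ← Matrix.add_mul, ← Matrix.mul_add, add_sub_cancel, hdiag,
        diagonal_apply_eq]
    rw [Finset.sum_congr rfl fun i _ => hEq i, Finset.sum_add_distrib]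
    have hb : ∑ i : Fin n with i.val < k, (Wᵀ * (S - S') * W) i i
        ≤ n * ∑ p : Fin n × Fin n, |S p.1 p.2 - S' p.1 p.2| := by
      rw [Fintype.sum_prod_type]
      calc _ ≤ ∑ i : Fin n with i.val < k, |(Wᵀ * (S - S') * W) i i| :=
            Finset.sum_le_sum fun i _ => le_abs_self _
        _ ≤ ∑ i : Fin n, |(Wᵀ * (S - S') * W) i i| :=
            Finset.sum_le_sum_of_subset_of_nonneg (Finset.filter_subset _ _)
              fun i _ _ => abs_nonneg _
        _ ≤ ∑ _i : Fin n, ∑ p, ∑ q, |(S - S') p q| :=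
            Finset.sum_le_sum fun i _ => abs_conj_apply_self_le hW _ i
        _ = _ := by simp
    linarith
  rw [abs_le]
  have h1 := aux hS hS'
  have h2 := aux hS' hS
  simp only [abs_sub_comm (S' _ _)] at h2
  constructor <;> linarith

end Matrix

/-! ### Eigenvalues along the Lyapunov flow -/

theorem sum_filter_val_lt_succ {n : ℕ} (f : Fin n → ℝ) (i : Fin n) :
    ∑ j : Fin n with j.val < i.val + 1, f j = ∑ j : Fin n with j.val < i.val, f j + f i := by
  have h : (Finset.univ.filter fun j : Fin n => j.val < i.val + 1)
      = insert i (Finset.univ.filter fun j : Fin n => j.val < i.val) := by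
    ext j
    simp only [Finset.mem_filter, Finset.mem_univ, true_and, Finset.mem_insert, Fin.ext_iff]
    omega
  rw [h, Finset.sum_insert (by simp), add_comm]

namespace Matrix

theorem trace_conj_of_mem_orthogonalGroup {n : ℕ} {Q : Matrix (Fin n) (Fin n) ℝ}
    (hQ : Q ∈ orthogonalGroup (Fin n) ℝ) (M : Matrix (Fin n) (Fin n) ℝ) :
    (Qᵀ * M * Q).trace = M.trace := by
  rw [trace_mul_cycle, mul_transpose_self_of_mem_orthogonalGroup hQ, Matrix.one_mul]

theorem absolutelyContinuous_sum_sortDesc_eigenvalues {n : ℕ} {a b : ℝ}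
    {S : ℝ → Matrix (Fin n) (Fin n) ℝ} (hS : ∀ t, (S t).IsHermitian)
    (hac : ∀ i j, AbsolutelyContinuousOnInterval (fun t => S t i j) a b) (k : ℕ) :
    AbsolutelyContinuousOnInterval
      (fun t => ∑ i : Fin n with i.val < k, sortDesc (hS t).eigenvalues i) a b :=
  .of_dist_le (s := Finset.univ) (g := fun (p : Fin n × Fin n) t => S t p.1 p.2) (C := n)
    (fun p _ => hac p.1 p.2)
    fun x _ y _ => (hS x).sum_sortDesc_eigenvalues_sub_le (hS y) k

theorem absolutelyContinuous_sortDesc_eigenvalues {n : ℕ} {a b : ℝ}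
    {S : ℝ → Matrix (Fin n) (Fin n) ℝ} (hS : ∀ t, (S t).IsHermitian)
    (hac : ∀ i j, AbsolutelyContinuousOnInterval (fun t => S t i j) a b) (i : Fin n) :
    AbsolutelyContinuousOnInterval (fun t => sortDesc (hS t).eigenvalues i) a b := by
  have h := (absolutelyContinuous_sum_sortDesc_eigenvalues hS hac (i.val + 1)).sub
    (absolutelyContinuous_sum_sortDesc_eigenvalues hS hac i.val)
  convert! h using 1
  ext t
  simp only [Pi.sub_apply]
  rw [sum_filter_val_lt_succ, add_sub_cancel_left]

/-- Along a solution of the Lyapunov equation, wherever the partial sums of the decreasing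
eigenvalues are differentiable, the derivatives of the eigenvalues are governed by the diagonal of
the gain in an eigenbasis. -/
theorem hasDerivAt_sortDesc_eigenvalues {n : ℕ} {t : ℝ} {A : Matrix (Fin n) (Fin n) ℝ}
    {S : ℝ → Matrix (Fin n) (Fin n) ℝ} (hS : ∀ t, (S t).IsHermitian)
    (hdiff : ∀ k : ℕ, DifferentiableAt ℝ
      (fun s => ∑ i : Fin n with i.val < k, sortDesc (hS s).eigenvalues i) t)
    (hder : ∀ i j, HasDerivAt (fun s => S s i j) ((A * S t + S t * A) i j) t) :
    ∃ W ∈ orthogonalGroup (Fin n) ℝ, ∀ i, HasDerivAt (fun s => sortDesc (hS s).eigenvalues i)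
      (2 * (Wᵀ * A * W) i i * sortDesc (hS t).eigenvalues i) t := by
  obtain ⟨W, hW, h⟩ := (hS t).exists_orthogonal_diagonal_sortDesc
  set l := sortDesc (hS t).eigenvalues with hl
  have hWW := transpose_mul_self_of_mem_orthogonalGroup hW
  have hSW : S t * W = W * diagonal l := by
    rw [h, Matrix.mul_assoc, hWW, Matrix.mul_one]
  have hWS : Wᵀ * S t = diagonal l * Wᵀ := by
    rw [h, Matrix.mul_assoc, ← Matrix.mul_assoc, hWW, Matrix.one_mul]
  have hdiag : ∀ i, (Wᵀ * S t * W) i i = l i := fun i => by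
    rw [hWS, Matrix.mul_assoc, hWW, Matrix.mul_one, diagonal_apply_eq]
  have hM : ∀ i, (Wᵀ * (A * S t + S t * A) * W) i i = 2 * (Wᵀ * A * W) i i * l i := fun i => by
    have : Wᵀ * (A * S t + S t * A) * W
        = (Wᵀ * A * W) * diagonal l + diagonal l * (Wᵀ * A * W) := by
      rw [Matrix.mul_add, Matrix.add_mul]
      congr 1
      · simp only [Matrix.mul_assoc, hSW]
      · rw [← Matrix.mul_assoc, hWS]
        simp only [Matrix.mul_assoc]
    rw [this, add_apply, mul_diagonal, diagonal_mul]
    ring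
  have hsum : ∀ k : ℕ, HasDerivAt
      (fun s => ∑ i : Fin n with i.val < k, sortDesc (hS s).eigenvalues i)
      (∑ i : Fin n with i.val < k, 2 * (Wᵀ * A * W) i i * l i) t := by
    intro k
    -- The basis `W` is frozen at time `t`, so the comparison function is linear in the entries of
    -- `S s`.
    refine HasDerivAt.of_le_of_eq
      (g := fun s => ∑ i : Fin n with i.val < k, (Wᵀ * S s * W) i i) (hdiff k) ?_
      (fun s => (hS s).sum_conj_le hW k) (Finset.sum_congr rfl fun i _ => hdiag i)
    refine HasDerivAt.fun_sum fun i _ => ?_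
    rw [← hM, transpose_mul_mul_apply_self]
    simp only [transpose_mul_mul_apply_self]
    exact HasDerivAt.fun_sum fun p _ => HasDerivAt.fun_sum fun q _ => (hder p q).const_mul _
  refine ⟨W, hW, fun i => ?_⟩
  have := (hsum (i.val + 1)).sub (hsum i.val)
  rw [sum_filter_val_lt_succ, add_sub_cancel_left] at this
  convert! this using 1
  ext s
  simp only [Pi.sub_apply]
  rw [sum_filter_val_lt_succ, add_sub_cancel_left]

theorem PosDef.sum_log_sortDesc_eigenvalues_le_of_lyapunov {n : ℕ} {T : ℝ} (hT : 0 ≤ T)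
    {D : Matrix (Fin n) (Fin n) ℝ} (hD : D.IsHermitian) {U S : ℝ → Matrix (Fin n) (Fin n) ℝ}
    (hU : ∀ t ∈ Set.Icc 0 T, U t ∈ orthogonalGroup (Fin n) ℝ) (hS : ∀ t, (S t).IsHermitian)
    (hL : IsLyapunovSolution T (fun t => U t * D * (U t)ᵀ) S) (h0 : (S 0).PosDef) :
    (∑ i, Real.log (sortDesc (hS T).eigenvalues i)
      = ∑ i, (Real.log (sortDesc (hS 0).eigenvalues i) + 2 * T * sortDesc hD.eigenvalues i)) ∧
    ∀ k : ℕ, ∑ i : Fin n with i.val < k, Real.log (sortDesc (hS T).eigenvalues i)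
      ≤ ∑ i : Fin n with i.val < k,
        (Real.log (sortDesc (hS 0).eigenvalues i) + 2 * T * sortDesc hD.eigenvalues i) := by
  have hac := absolutelyContinuous_sortDesc_eigenvalues hS hL.absolutelyContinuous
  have hder : ∀ᵐ t ∂(volume.restrict (Set.Icc 0 T)), ∃ Q ∈ orthogonalGroup (Fin n) ℝ,
      ∀ i, HasDerivAt (fun s => sortDesc (hS s).eigenvalues i)
        (2 * (Qᵀ * D * Q) i i * sortDesc (hS t).eigenvalues i) t := by
    have hdiff : ∀ᵐ t ∂(volume.restrict (Set.Icc 0 T)), ∀ k : ℕ, DifferentiableAt ℝ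
        (fun s => ∑ i : Fin n with i.val < k, sortDesc (hS s).eigenvalues i) t := by
      rw [ae_all_iff]
      intro k
      rw [ae_restrict_iff' measurableSet_Icc, ← Set.uIcc_of_le hT]
      exact (absolutelyContinuous_sum_sortDesc_eigenvalues hS
        hL.absolutelyContinuous k).ae_differentiableAt
    filter_upwards [hdiff, hL.equation, ae_restrict_mem measurableSet_Icc] with t h1 h2 h3
    obtain ⟨W, hW, h⟩ := hasDerivAt_sortDesc_eigenvalues hS h1 h2
    -- Absorbing the control into the eigenbasis leaves the constant matrix `D`.
    refine ⟨(U t)ᵀ * W, mul_mem (transpose_mem_orthogonalGroup (hU t h3)) hW, fun i => ?_⟩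
    have e : ((U t)ᵀ * W)ᵀ * D * ((U t)ᵀ * W) = Wᵀ * (U t * D * (U t)ᵀ) * W := by
      simp only [transpose_mul, transpose_transpose, Matrix.mul_assoc]
    rw [e]
    exact h i
  have hpos : ∀ i, ∀ t ∈ Set.uIcc 0 T, 0 < sortDesc (hS t).eigenvalues i := by
    intro i
    rw [Set.uIcc_of_le hT]
    refine (hac i).pos_of_ae_hasDerivAt_mul (C := 2 * ∑ p, ∑ q, |D p q|)
      (h0.eigenvalues_pos _) ?_
    filter_upwards [hder] with t ⟨Q, hQ, h⟩
    refine ⟨_, h i, ?_⟩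
    rw [abs_mul, abs_two]
    exact mul_le_mul_of_nonneg_left (abs_conj_apply_self_le hQ D i) zero_le_two
  have hlogac : ∀ s : Finset (Fin n), AbsolutelyContinuousOnInterval
      (fun t => ∑ i ∈ s, Real.log (sortDesc (hS t).eigenvalues i)) 0 T := fun s =>
    .finset_sum fun i _ => (hac i).log (hpos i)
  have hlogder : ∀ᵐ t ∂(volume.restrict (Set.Icc 0 T)), ∃ Q ∈ orthogonalGroup (Fin n) ℝ,
      ∀ s : Finset (Fin n), HasDerivAt
        (fun t => ∑ i ∈ s, Real.log (sortDesc (hS t).eigenvalues i))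
        (∑ i ∈ s, 2 * (Qᵀ * D * Q) i i) t := by
    filter_upwards [hder, ae_restrict_mem measurableSet_Icc] with t ⟨Q, hQ, h⟩ ht
    refine ⟨Q, hQ, fun s => HasDerivAt.fun_sum fun i _ => ?_⟩
    have hp := (hpos i t (by rwa [Set.uIcc_of_le hT])).ne'
    convert! (h i).log hp using 1
    rw [mul_div_assoc, div_self hp, mul_one]
  constructor
  · have htr : ∀ Q ∈ orthogonalGroup (Fin n) ℝ, ∑ i, 2 * (Qᵀ * D * Q) i i
        = 2 * ∑ i, sortDesc hD.eigenvalues i := by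
      intro Q hQ
      have h1 := trace_conj_of_mem_orthogonalGroup hQ D
      have h2 := hD.trace_eq_sum_eigenvalues
      rw [← Finset.mul_sum, sum_sortDesc]
      simp only [trace, diag_apply, RCLike.ofReal_real_eq_id, id] at h1 h2 ⊢
      rw [h1, h2]
    have hle := (hlogac Finset.univ).sub_le_of_ae_hasDerivAt_le hT
      (c := 2 * ∑ i, sortDesc hD.eigenvalues i) (by
        filter_upwards [hlogder] with t ⟨Q, hQ, h⟩
        exact ⟨_, h _, (htr Q hQ).le⟩)
    -- The trace makes the rate of the full sum constant, so the bound also applies to the negated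
    -- function, giving equality.
    have hge := (hlogac Finset.univ).neg.sub_le_of_ae_hasDerivAt_le hT
      (c := -(2 * ∑ i, sortDesc hD.eigenvalues i)) (by
        filter_upwards [hlogder] with t ⟨Q, hQ, h⟩
        exact ⟨_, (h _).neg, (neg_inj.2 (htr Q hQ)).le⟩)
    simp only [Pi.neg_apply] at hge
    rw [Finset.sum_add_distrib, ← Finset.mul_sum]
    linarith
  · intro k
    have hle := (hlogac (Finset.univ.filter fun i => i.val < k)).sub_le_of_ae_hasDerivAt_le hT
      (c := 2 * ∑ i : Fin n with i.val < k, sortDesc hD.eigenvalues i) (by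
        filter_upwards [hlogder] with t ⟨Q, hQ, h⟩
        refine ⟨_, h _, ?_⟩
        rw [← Finset.mul_sum]
        exact mul_le_mul_of_nonneg_left (hD.sum_conj_le hQ k) zero_le_two)
    rw [Finset.sum_add_distrib, ← Finset.mul_sum]
    linarith

end Matrix

/-- The symmetric part of a solution of the Lyapunov equation with symmetric gain is again a
solution. -/
theorem IsLyapunovSolution.symmetricPart {n : ℕ} {T : ℝ} {A S : ℝ → Matrix (Fin n) (Fin n) ℝ}
    (hA : ∀ t, (A t).IsSymm) (h : IsLyapunovSolution T A S) :
    IsLyapunovSolution T A (fun t => (2⁻¹ : ℝ) • (S t + (S t).transpose)) where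
  absolutelyContinuous i j :=
    ((h.absolutelyContinuous i j).add (h.absolutelyContinuous j i)).const_mul 2⁻¹
  equation := by
    filter_upwards [h.equation] with t ht i j
    have h1 := ((ht i j).add (ht j i)).const_mul (2⁻¹ : ℝ)
    convert! h1 using 1
    have e : A t * ((2⁻¹ : ℝ) • (S t + (S t).transpose))
        + ((2⁻¹ : ℝ) • (S t + (S t).transpose)) * A t
        = (2⁻¹ : ℝ) • ((A t * S t + S t * A t) + (A t * S t + S t * A t).transpose) := by
      rw [Matrix.transpose_add, Matrix.transpose_mul, Matrix.transpose_mul, (hA t).eq,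
        Matrix.mul_smul, Matrix.smul_mul, ← smul_add, Matrix.mul_add, Matrix.add_mul]
      congr 1
      abel
    rw [e]
    rfl

theorem theorem1 {n : ℕ} {S₀ S_T D : Matrix (Fin n) (Fin n) ℝ} {T : ℝ}
    (hS₀ : S₀.PosDef) (hD : D.IsDiag) (hT : 0 ≤ T) (h : S_T ∈ reachableSet S₀ D T) :
    Majorized (isHermitian_matrixLog S_T).eigenvalues
      (sortDesc (isHermitian_matrixLog S₀).eigenvalues
        + (2 * T) • sortDesc (isHermitian_of_isDiag hD).eigenvalues) := by
  obtain ⟨hS_T, U, S, hU, hL, h0, hST⟩ := h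
  -- Symmetry of `S t` is not assumed at intermediate times; the symmetric part has the same
  -- endpoints and is Hermitian for every real `t`.
  have hR := hL.symmetricPart fun t => by
    rw [Matrix.IsSymm, Matrix.transpose_mul, Matrix.transpose_mul, Matrix.transpose_transpose,
      hD.isSymm.eq, Matrix.mul_assoc]
  set R : ℝ → Matrix (Fin n) (Fin n) ℝ := fun t => (2⁻¹ : ℝ) • (S t + (S t).transpose) with hRdef
  have hRherm : ∀ t, (R t).IsHermitian := fun t => by
    rw [Matrix.IsHermitian, Matrix.conjTranspose_eq_transpose_of_trivial, hRdef]
    simp [add_comm]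
  have hsymm : ∀ {M : Matrix (Fin n) (Fin n) ℝ}, M.PosDef →
      (2⁻¹ : ℝ) • (M + M.transpose) = M := fun {M} hM => by
    have : M.transpose = M := by
      rw [← Matrix.conjTranspose_eq_transpose_of_trivial]
      exact hM.isHermitian
    rw [this, ← two_smul ℝ M, smul_smul]
    norm_num
  have hR0 : R 0 = S₀ := by simpa only [hRdef, h0] using hsymm hS₀
  have hRT : R T = S_T := by simpa only [hRdef, hST] using hsymm hS_T
  obtain ⟨heq, hle⟩ := Matrix.PosDef.sum_log_sortDesc_eigenvalues_le_of_lyapunov hT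
    (isHermitian_of_isDiag hD) hU.orthogonal hRherm hR (hR0 ▸ hS₀)
  have hev : ∀ {t : ℝ} {M : Matrix (Fin n) (Fin n) ℝ} (hM : M.IsHermitian), R t = M →
      (hRherm t).eigenvalues = hM.eigenvalues := by
    rintro t _ _ rfl
    rfl
  rw [hev hS₀.isHermitian hR0, hev hS_T.isHermitian hRT] at heq
  simp only [hev hS₀.isHermitian hR0, hev hS_T.isHermitian hRT] at hle
  -- Since `T ≥ 0`, the right-hand vector is already sorted, so `sortDesc` leaves it unchanged.
  have hanti : Antitone (sortDesc (isHermitian_matrixLog S₀).eigenvalues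
      + (2 * T) • sortDesc (isHermitian_of_isDiag hD).eigenvalues) :=
    fun _ _ hij => add_le_add (sortDesc_antitone _ hij)
      (mul_le_mul_of_nonneg_left (sortDesc_antitone _ hij) (mul_nonneg zero_le_two hT))
  refine ⟨?_, fun k _ _ => ?_⟩
  · rw [← sum_sortDesc, sortDesc_eigenvalues_matrixLog hS_T, sortDesc_eigenvalues_matrixLog hS₀]
    exact heq
  · rw [sortDesc_eq_self hanti, sortDesc_eigenvalues_matrixLog hS_T,
      sortDesc_eigenvalues_matrixLog hS₀]
    exact hle k
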